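/- Let $G$ be a Polish group and $X$ a Polish $G$-space, i.e. a Polish space with a continuous action of $G$; let $E_X$ be its orbit equivalence relation. For $x,y\in X$ and an ordinal $\alpha<\omega_1$, consider the following infinite game $\mathrm{Appr}_\alpha(x,y)$ between Odd and Eve. Put $x_0=x$, $y_0=y$, $V^y_0=G$, $U^y_0=X$, $\alpha_0=\alpha$. In turn $2n+1$ ($n\ge 0$), Odd either sets $V^x_n=V^y_n$ and $\alpha_{2n+1}=\alpha_{2n}$, or plays a new open neighborhood $V^x_n$ of $1$ in $G$ and an ordinal $\alpha_{2n+1}<\alpha_{2n}$; moreover, he plays an open neighborhood $U^x_n$ of $x_n$. Eve replies with $g^y_n\in G$, and $y_{n+1}=g^y_n.y_n$. In turn $2n+2$ ($n\ge 0$), Odd either sets $V^y_{n+1}=V^x_n$ and $\alpha_{2n+2}=\alpha_{2n+1}$, or plays a new open neighborhood $V^y_{n+1}$ of $1$ in $G$ and an ordinal $\alpha_{2n+2}<\alpha_{2n+1}$; moreover, he plays an open neighborhood $U^y_{n+1}$ of $y_{n+1}$. Eve replies with $g^x_n\in G$, and $x_{n+1}=g^x_n.x_n$. Eve wins if for every $n\ge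 0$: - $y_{n+1}\in\overline{U^x_n}$ and $x_n\in\overline{U^y_n}$; - $g^y_n=h_k\cdots h_0$ for some $k\ge 0$ and $h_0,\dots,h_k\in V^y_n$ such that $h_i\cdots h_0.y_n\in U^y_n$ for all $i\le k$; - $g^x_n=h_k\cdots h_0$ for some $k\ge 0$ and $h_0,\dots,h_k\in V^x_n$ such that $h_i\cdots h_0.x_n\in U^x_n$ for all $i\le k$. Write $x\sim_\alpha y$ if Eve has a winning strategy in $\mathrm{Appr}_\alpha(x,y)$. **Proposition.** Let $G,H$ be Polish groups, $X$ a Polish $G$-space, $Y$ a Polish $H$-space, and let $f:X\to Y$ be Baire-measurable (preimages of open sets have the Baire property) and an $(E_X,E_Y)$-homomorphism ($x_1\,E_X\,x_2$ implies $f(x_1)\,E_Y\,f(x_2)$). Then for every $\alpha<\omega_1$ there is a $G$-invariant comeager set $X_0\subseteq X$ such that, for all $x,y\in X_0$, $x\sim_\alpha y$ implies $f(x)\sim_\alpha f(y)$. -/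

import Mathlib

namespace ApprGame

universe u v

/-- A move of Odd: an open set of points `nbhd`, a neighborhood `grp` of the identity, and the
current ordinal `rank`. -/
structure OddMove (G : Type u) (X : Type v) where
  nbhd : Set X
  grp : Set G
  rank : Ordinal.{0}

/-- `leftProd h i = h i * ⋯ * h 1 * h 0`. -/
def leftProd {G : Type u} [Group G] (h : ℕ → G) : ℕ → G
  | 0 => h 0
  | i + 1 => h (i + 1) * leftProd h i

/-- `g = h k * ⋯ * h 0` for some `k ≥ 0` and `h 0, …, h k ∈ V` such that
`(h i * ⋯ * h 0) • z ∈ U` for all `i ≤ k`. -/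
def Reaches {G : Type u} {X : Type v} [Group G] [MulAction G X]
    (V : Set G) (U : Set X) (z : X) (g : G) : Prop :=
  ∃ (k : ℕ) (h : ℕ → G), g = leftProd h k ∧ (∀ i ≤ k, h i ∈ V) ∧ ∀ i ≤ k, leftProd h i • z ∈ U

/-! A play is a sequence `odd : ℕ → OddMove G X` of moves of Odd with a sequence `eve : ℕ → G` of
replies of Eve. The entries with index `t` are the moves in the turn number `t + 1`, so that
`odd (2 * n)` is `(U^x_n, V^x_n, α_{2n+1})`, `eve (2 * n)` is `g^y_n`,
`odd (2 * n + 1)` is `(U^y_{n+1}, V^y_{n+1}, α_{2n+2})` and `eve (2 * n + 1)` is `g^x_n`. -/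

/-- The points `x_n`. -/
def xPt {G : Type u} {X : Type v} [Group G] [MulAction G X] (x : X) (eve : ℕ → G) : ℕ → X
  | 0 => x
  | n + 1 => eve (2 * n + 1) • xPt x eve n

/-- The points `y_n`. -/
def yPt {G : Type u} {X : Type v} [Group G] [MulAction G X] (y : X) (eve : ℕ → G) : ℕ → X
  | 0 => y
  | n + 1 => eve (2 * n) • yPt y eve n

/-- The sets `U^x_n`. -/
def xSet {G : Type u} {X : Type v} (odd : ℕ → OddMove G X) (n : ℕ) : Set X :=
  (odd (2 * n)).nbhd

/-- The sets `U^y_n`, where `U^y_0 = U`. -/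
def ySet {G : Type u} {X : Type v} (U : Set X) (odd : ℕ → OddMove G X) : ℕ → Set X
  | 0 => U
  | n + 1 => (odd (2 * n + 1)).nbhd

/-- The sets `V^x_n`. -/
def xGrp {G : Type u} {X : Type v} (odd : ℕ → OddMove G X) (n : ℕ) : Set G :=
  (odd (2 * n)).grp

/-- The sets `V^y_n`, where `V^y_0 = V`. -/
def yGrp {G : Type u} {X : Type v} (V : Set G) (odd : ℕ → OddMove G X) : ℕ → Set G
  | 0 => V
  | n + 1 => (odd (2 * n + 1)).grp

/-- The ordinals `α_t`, where `α_0 = α`. -/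
def rk {G : Type u} {X : Type v} (α : Ordinal.{0}) (odd : ℕ → OddMove G X) : ℕ → Ordinal.{0}
  | 0 => α
  | t + 1 => (odd t).rank

/-- From the previous neighborhood `V` and ordinal `α`, Odd passes to `V'` and `α'`: either both
are kept, or a new `V' ∈ 𝒱` is played and the ordinal drops. -/
def Passes {G : Type u} (𝒱 : Set (Set G)) (V : Set G) (α : Ordinal.{0})
    (V' : Set G) (α' : Ordinal.{0}) : Prop :=
  (V' = V ∧ α' = α) ∨ (V' ∈ 𝒱 ∧ α' < α)

/-- All the moves of Odd in the play are legal. -/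
def OddLegal {G : Type u} {X : Type v} [Group G] [MulAction G X] [TopologicalSpace X]
    (α : Ordinal.{0}) (x y : X) (𝒱 : Set (Set G)) (V : Set G)
    (odd : ℕ → OddMove G X) (eve : ℕ → G) : Prop :=
  ∀ n : ℕ,
    (Passes 𝒱 (yGrp V odd n) (rk α odd (2 * n)) (xGrp odd n) (rk α odd (2 * n + 1)) ∧
      IsOpen (xSet odd n) ∧ xPt x eve n ∈ xSet odd n) ∧
    (Passes 𝒱 (xGrp odd n) (rk α odd (2 * n + 1)) (yGrp V odd (n + 1)) (rk α odd (2 * n + 2)) ∧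
      IsOpen (odd (2 * n + 1)).nbhd ∧ yPt y eve (n + 1) ∈ (odd (2 * n + 1)).nbhd)

/-- The winning condition of Eve. -/
def EveWins {G : Type u} {X : Type v} [Group G] [MulAction G X] [TopologicalSpace X]
    (x y : X) (V : Set G) (U : Set X) (odd : ℕ → OddMove G X) (eve : ℕ → G) : Prop :=
  ∀ n : ℕ,
    yPt y eve (n + 1) ∈ closure (xSet odd n) ∧
    xPt x eve n ∈ closure (ySet U odd n) ∧
    Reaches (yGrp V odd n) (ySet U odd n) (yPt y eve n) (eve (2 * n)) ∧
    Reaches (xGrp odd n) (xSet odd n) (xPt x eve n) (eve (2 * n + 1))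

/-- A strategy of Eve: her reply to each finite sequence of moves of Odd. (Her own earlier replies
are determined by the strategy and the earlier moves of Odd.) -/
def Strategy (G : Type u) (X : Type v) : Type (max u v 1) :=
  (t : ℕ) → (Fin (t + 1) → OddMove G X) → G

/-- The replies of Eve when she follows `σ` against the moves `odd`. -/
def Strategy.replies {G : Type u} {X : Type v} (σ : Strategy G X) (odd : ℕ → OddMove G X) :
    ℕ → G :=
  fun t => σ t (fun i => odd i)

/-- Eve has a winning strategy in the game `Appr_α(x, y, 𝒱, V, U)`. -/
def EveHasWinningStrategy {G : Type u} {X : Type v} [Group G] [MulAction G X] [TopologicalSpace X]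
    (α : Ordinal.{0}) (x y : X) (𝒱 : Set (Set G)) (V : Set G) (U : Set X) : Prop :=
  ∃ σ : Strategy G X, ∀ odd : ℕ → OddMove G X,
    OddLegal α x y 𝒱 V odd (σ.replies odd) → EveWins x y V U odd (σ.replies odd)

/-- The relation `x ∼_α y` of the action of `G` on `X`: Eve has a winning strategy in
`Appr_α(x, y, 𝒰, G, X)`, where `𝒰` consists of all the open neighborhoods of the identity. -/
def Sim (G : Type u) {X : Type v} [Group G] [TopologicalSpace G] [MulAction G X]
    [TopologicalSpace X] (α : Ordinal.{0}) (x y : X) : Prop :=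
  EveHasWinningStrategy α x y {W : Set G | IsOpen W ∧ (1 : G) ∈ W} Set.univ Set.univ

/-- Preimages of open sets have the Baire property. -/
def BaireMeasurable {X Y : Type*} [TopologicalSpace X] [TopologicalSpace Y] (f : X → Y) : Prop :=
  ∀ s : Set Y, IsOpen s → BaireMeasurableSet (f ⁻¹' s)

/-- `f` is a homomorphism from the orbit equivalence relation of `G` on `X` to that of `H`
on `Y`. -/
def IsOrbitHom (G H : Type*) {X Y : Type*} [Group G] [MulAction G X] [Group H] [MulAction H Y]
    (f : X → Y) : Prop :=
  ∀ x₁ x₂ : X, MulAction.orbitRel G X x₁ x₂ → MulAction.orbitRel H Y (f x₁) (f x₂)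

end ApprGame

namespace ApprGame

open Set Filter Topology

/-! The heart is a local regularity of the homomorphism: there is a comeager `C` on which `f` is
continuous and such that, near each point of `C`, steps by small group elements between points of
`C` are sent to steps by small elements of `H` (`exists_comeager_tracks`). For generic `(x, g)`, `f
(g • x)` lies in one of countably many sets `W' * b • f x`. Each such condition is analytic, hence
open up to a meager set, so generically it persists under small changes of `g`; two elements of the
same `W' * b` differ by a small element, so `f (h • z) ∈ W • f z` for generic `z` in some open set
and `h` near `1`.

A winning strategy of Eve is an invariant set of positions (`Sustains`). If `C` contains all the
points that occur, a strategy for `(x, y)` is copied to `(f x, f y)`: each move of Odd in `Y` is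
pulled back to a smaller basic move in `X`, and Eve's path there is mapped by `f` step by step
(`SustainsThrough.sim_map`).

A strategy meets many points outside `C`, but the copying needs only basic moves of Odd with
ordinals at most `α`. As `α < ω₁`, these are countably many, so countably many points `Z` suffice
(`Sim.exists_countable`). Let `X₀` be the set of points almost all of whose translates lie in `C`;
it is invariant, and comeager by Kuratowski–Ulam. For `x, y ∈ X₀` we have `Z ⊆ X₀`, so a single `ε`
moves all of `Z` into `C`. The transfer is applied to a translate of `z ↦ f (ε • z)`, which takes
values in the same orbits as `f`. -/

/-- Kuratowski–Ulam, for comeager sets: almost all sections of a comeager set are comeager. -/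
theorem eventually_residual_section {A B : Type*} [TopologicalSpace A] [TopologicalSpace B]
    [SecondCountableTopology B] {p : A × B → Prop} (hp : ∀ᶠ z in residual (A × B), p z) :
    ∀ᶠ a in residual A, ∀ᶠ b in residual B, p (a, b) := by
  obtain ⟨S, hSo, hSd, hSc, hS⟩ := mem_residual_iff.1 hp
  have key : ∀ O ∈ S, ∀ᶠ a in residual A, Dense {b : B | (a, b) ∈ O} := by
    intro O hO
    have h1 : ∀ V ∈ TopologicalSpace.countableBasis B,
        ∀ᶠ a in residual A, ∃ b ∈ V, (a, b) ∈ O := by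
      intro V hV
      have hVo := TopologicalSpace.isOpen_of_mem_countableBasis hV
      have hVn := TopologicalSpace.nonempty_of_mem_countableBasis hV
      have heq : {a : A | ∃ b ∈ V, (a, b) ∈ O} = Prod.fst '' (O ∩ univ ×ˢ V) := by
        ext a
        simp only [mem_ofPred_eq, mem_image, mem_inter_iff, mem_prod, mem_univ, true_and,
          Prod.exists, exists_and_right, exists_eq_right]
        exact exists_congr fun b => and_comm
      refine residual_of_dense_open (s := {a : A | ∃ b ∈ V, (a, b) ∈ O}) ?_ ?_
      · rw [heq]
        exact isOpenMap_fst _ ((hSo O hO).inter (isOpen_univ.prod hVo))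
      · rw [dense_iff_inter_open]
        intro N hN hNn
        obtain ⟨⟨a, b⟩, hab, haO⟩ := (hSd O hO).inter_open_nonempty (N ×ˢ V) (hN.prod hVo)
          (hNn.prod hVn)
        exact ⟨a, hab.1, b, hab.2, haO⟩
    filter_upwards [(eventually_countable_ball (TopologicalSpace.countable_countableBasis B)).2 h1]
      with a ha
    rw [(TopologicalSpace.isBasis_countableBasis B).dense_iff]
    intro V hV hVn
    obtain ⟨b, hb, hab⟩ := ha V hV
    exact ⟨b, hb, hab⟩
  filter_upwards [(eventually_countable_ball hSc).2 key] with a ha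
  have h2 : ∀ O ∈ S, ∀ᶠ b in residual B, (a, b) ∈ O := fun O hO =>
    residual_of_dense_open (s := {b : B | (a, b) ∈ O})
      ((hSo O hO).preimage (Continuous.prodMk_right a)) (ha O hO)
  filter_upwards [(eventually_countable_ball hSc).2 h2] with b hb
  exact hS (mem_sInter.2 hb)

/-! ### Category hulls and the Baire property of analytic preimages -/

section Hull

variable {P : Type*} [TopologicalSpace P]

/-- The points at which the set `A` is nowhere locally meager. -/
def categoryHull (A : Set P) : Set P :=
  {p | ∀ V : Set P, IsOpen V → p ∈ V → ¬ IsMeagre (V ∩ A)}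

theorem isClosed_categoryHull (A : Set P) : IsClosed (categoryHull A) := by
  rw [← isOpen_compl_iff, isOpen_iff_forall_mem_open]
  intro p hp
  simp only [categoryHull, mem_compl_iff, mem_ofPred_eq, not_forall, not_not] at hp
  obtain ⟨V, hV, hpV, hm⟩ := hp
  exact ⟨V, fun q hq h => h V hV hq hm, hV, hpV⟩

theorem categoryHull_subset_closure (A : Set P) : categoryHull A ⊆ closure A := by
  intro p hp
  rw [mem_closure_iff]
  exact fun V hV hpV => nonempty_of_not_isMeagre (hp V hV hpV)

theorem isMeagre_diff_categoryHull [SecondCountableTopology P] (A : Set P) :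
    IsMeagre (A \ categoryHull A) := by
  let 𝒮 : Set (Set P) := {V ∈ TopologicalSpace.countableBasis P | IsMeagre (V ∩ A)}
  have hc : 𝒮.Countable := (TopologicalSpace.countable_countableBasis P).mono (sep_subset _ _)
  have : Countable 𝒮 := hc.to_subtype
  refine IsMeagre.mono ?_ (isMeagre_iUnion (f := fun V : 𝒮 => V.1 ∩ A) fun V => V.2.2)
  rintro p ⟨hpA, hp⟩
  simp only [categoryHull, mem_ofPred_eq, not_forall, not_not] at hp
  obtain ⟨V, hV, hpV, hm⟩ := hp
  obtain ⟨V', hV', hpV', hsub⟩ :=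
    (TopologicalSpace.isBasis_countableBasis P).exists_subset_of_mem_open hpV hV
  exact mem_iUnion.2 ⟨⟨V', hV', hm.mono (inter_subset_inter_left _ hsub)⟩, hpV', hpA⟩

theorem eventually_mem_interior_of_isClosed {D : Set P} (hD : IsClosed D) :
    ∀ᶠ p in residual P, p ∈ D → p ∈ interior D := by
  have : IsMeagre (frontier D) :=
    IsNowhereDense.isMeagre (by rw [IsNowhereDense, isClosed_frontier.closure_eq,
      interior_frontier hD])
  filter_upwards [this] with p hp hpD
  by_contra h
  exact hp ⟨subset_closure hpD, h⟩

/-- Almost every point of `B i` lies in the interior of the hull of `B i`, so `A` is meager off the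
closure of the union `W` of these interiors. As `W` is open, its closure adds only a meager set. -/
theorem eventually_categoryHull_of_subset_iUnion [SecondCountableTopology P] {A : Set P}
    {ι : Type*} [Countable ι] {B : ι → Set P} (hAB : A ⊆ ⋃ i, B i) :
    ∀ᶠ p in residual P, p ∈ categoryHull A → ∃ i, p ∈ categoryHull (B i) := by
  set W : Set P := ⋃ i, interior (categoryHull (B i)) with hW
  have hWo : IsOpen W := isOpen_iUnion fun _ => isOpen_interior
  have hsub : categoryHull A ⊆ closure W := by
    intro p hp
    by_contra hpW
    refine hp (closure W)ᶜ isClosed_closure.isOpen_compl hpW ?_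
    have h1 : ∀ᶠ q in residual P, ∀ i, q ∈ B i → q ∈ categoryHull (B i) := by
      rw [eventually_countable_forall]
      intro i
      filter_upwards [isMeagre_diff_categoryHull (B i)] with q hq hqB
      by_contra h
      exact hq ⟨hqB, h⟩
    have h2 : ∀ᶠ q in residual P, ∀ i, q ∈ categoryHull (B i) → q ∈ interior (categoryHull (B i)) :=
      eventually_countable_forall.2 fun i =>
        eventually_mem_interior_of_isClosed (isClosed_categoryHull (B i))
    filter_upwards [h1, h2] with q hq1 hq2 hq
    obtain ⟨i, hi⟩ := mem_iUnion.1 (hAB hq.2)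
    exact hq.1 (subset_closure (mem_iUnion.2 ⟨i, hq2 i (hq1 i hi)⟩))
  filter_upwards [(closure_residualEq hWo.isLocallyClosed).mem_iff] with p hp hpA
  obtain ⟨i, hi⟩ := mem_iUnion.1 (hp.1 (hsub hpA))
  exact ⟨i, interior_subset hi⟩

/-- The preimage of an analytic set under a map that is continuous on a comeager set is open up to
a meager set. -/
theorem exists_isOpen_eventually_mem_iff [SecondCountableTopology P] {Y : Type*}
    [TopologicalSpace Y] [T3Space Y] {C : Set P} (hC : C ∈ residual P) {φ : P → Y}
    (hφ : ContinuousOn φ C) {ψ : (ℕ → ℕ) → Y} (hψ : Continuous ψ) :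
    ∃ O : Set P, IsOpen O ∧ ∀ᶠ p in residual P, p ∈ O ↔ φ p ∈ range ψ := by
  -- A Souslin scheme. As with `PiNat.res`, lists carry the latest entry first, so `j :: l` extends
  -- the initial segment `l`.
  let A : List ℕ → Set P := fun l => {p | p ∈ C ∧ ∃ q, PiNat.res q l.length = l ∧ φ p = ψ q}
  have hA : ∀ l, A l ⊆ ⋃ j, A (j :: l) := by
    rintro l p ⟨hp, q, hq, hpq⟩
    refine mem_iUnion.2 ⟨q l.length, hp, q, ?_, hpq⟩
    rw [List.length_cons, PiNat.res_succ, hq]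
  refine ⟨interior (categoryHull (A [])), isOpen_interior, ?_⟩
  have h1 : ∀ᶠ p in residual P, ∀ l, p ∈ categoryHull (A l) → ∃ j, p ∈ categoryHull (A (j :: l)) :=
    eventually_countable_forall.2 fun l => eventually_categoryHull_of_subset_iUnion (hA l)
  filter_upwards [hC, h1, isMeagre_diff_categoryHull (A []),
    eventually_mem_interior_of_isClosed (isClosed_categoryHull (A []))] with p hpC hp1 hp2 hp3
  constructor
  · intro hp
    replace hp := interior_subset hp
    choose! j hj using hp1
    let L : ℕ → List ℕ := fun n => Nat.rec [] (fun _ l => j l :: l) n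
    have hL : ∀ n, p ∈ categoryHull (A (L n)) := by
      intro n
      induction n with
      | zero => exact hp
      | succ n ih => exact hj _ ih
    -- The branch along which `p` stays in all the hulls. Each `A (L n)` accumulates at `p`, and its
    -- `φ`-values come from `ψ` near `q`; continuity on `C` and regularity of `Y` force `ψ q = φ p`.
    let q : ℕ → ℕ := fun n => j (L n)
    have hq : ∀ n, PiNat.res q n = L n := by
      intro n
      induction n with
      | zero => rfl
      | succ n ih => rw [PiNat.res_succ, ih]
    refine ⟨q, ?_⟩
    by_contra hne
    obtain ⟨S, ⟨hS, hSc⟩, hSφ⟩ := ((closed_nhds_basis (ψ q)).mem_iff).1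
      (isOpen_compl_singleton.mem_nhds (show ψ q ∈ ({φ p}ᶜ : Set Y) from hne))
    obtain ⟨V, ⟨x, n, rfl⟩, hqV, hVS⟩ :=
      (PiNat.isTopologicalBasis_cylinders (fun _ : ℕ => ℕ)).mem_nhds_iff.1
        (hψ.continuousAt.preimage_mem_nhds hS)
    have hsub : A (L n) ⊆ C ∩ φ ⁻¹' S := by
      rintro p' ⟨hp', q', hq', hpq'⟩
      refine ⟨hp', ?_⟩
      rw [mem_preimage, hpq']
      apply hVS
      rw [← PiNat.mem_cylinder_iff_eq.1 hqV, PiNat.cylinder_eq_res]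
      rw [← hq, PiNat.res_length] at hq'
      exact hq'
    have hcl := closure_mono hsub (categoryHull_subset_closure _ (hL n))
    have : φ p ∈ closure S :=
      closure_mono (image_subset_iff.2 fun x hx => hx.2)
        (((hφ p hpC).mono inter_subset_left).mem_closure_image hcl)
    rw [hSc.closure_eq] at this
    exact hSφ this rfl
  · rintro ⟨q, hq⟩
    refine hp3 ?_
    by_contra h
    exact hp2 ⟨⟨hpC, q, rfl, hq.symm⟩, h⟩

end Hull

/-! ### Genericity along the action -/

section Action

variable {G X : Type*} [Group G] [TopologicalSpace G] [TopologicalSpace X] [MulAction G X]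
  [ContinuousSMul G X]

theorem isOpenMap_action [ContinuousInv G] : IsOpenMap (fun p : X × G => p.2 • p.1) := by
  let e : X × G ≃ₜ X × G :=
    { toFun := fun p => (p.2 • p.1, p.2)
      invFun := fun p => (p.2⁻¹ • p.1, p.2)
      left_inv := fun p => by simp
      right_inv := fun p => by simp
      continuous_toFun := by fun_prop
      continuous_invFun := by fun_prop }
  exact isOpenMap_fst.comp e.isOpenMap

theorem tendsto_action_residual [ContinuousInv G] :
    Tendsto (fun p : X × G => p.2 • p.1) (residual (X × G)) (residual X) :=
  tendsto_residual_of_isOpenMap (by fun_prop) isOpenMap_action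

end Action

theorem BaireMeasurable.exists_continuousOn {X Y : Type*} [TopologicalSpace X] [TopologicalSpace Y]
    [SecondCountableTopology Y] {f : X → Y} (hf : BaireMeasurable f) :
    ∃ C ∈ residual X, ContinuousOn f C := by
  have h : ∀ s : Set Y, ∃ u : Set X, IsOpen s → IsOpen u ∧ ∀ᶠ x in residual X, f x ∈ s ↔ x ∈ u := by
    intro s
    by_cases hs : IsOpen s
    · obtain ⟨u, hu, hsu⟩ := (hf s hs).residualEq_isOpen
      exact ⟨u, fun _ => ⟨hu, hsu.mem_iff⟩⟩
    · exact ⟨∅, fun h => absurd h hs⟩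
  choose u hu using h
  have hb := TopologicalSpace.isBasis_countableBasis Y
  refine ⟨{x | ∀ s ∈ TopologicalSpace.countableBasis Y, f x ∈ s ↔ x ∈ u s}, ?_, ?_⟩
  · exact (eventually_countable_ball (TopologicalSpace.countable_countableBasis Y)).2
      fun s hs => (hu s (hb.isOpen hs)).2
  · intro x hx
    rw [ContinuousWithinAt, hb.nhds_hasBasis.tendsto_right_iff]
    rintro s ⟨hs, hxs⟩
    filter_upwards [mem_nhdsWithin_of_mem_nhds
      ((hu s (hb.isOpen hs)).1.mem_nhds ((hx s hs).1 hxs)), self_mem_nhdsWithin] with x' hx' hxC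
    exact (hxC s hs).2 hx'

/-! ### Small steps are mapped to small steps -/

section OrbitContinuity

variable {G H X Y : Type*}
  [Group G] [TopologicalSpace G] [IsTopologicalGroup G] [PolishSpace G]
  [Group H] [TopologicalSpace H] [PolishSpace H]
  [TopologicalSpace X] [PolishSpace X] [MulAction G X] [ContinuousSMul G X]
  [TopologicalSpace Y] [PolishSpace Y] [MulAction H Y] [ContinuousSMul H Y]

/-- The condition says that `(f x, f (g • x))` lies in the image of `Y × S` under `(y, s) ↦ (y, s •
y)`, an analytic set. -/
theorem exists_isOpen_translates {f : X → Y} {C : Set X} (hC : C ∈ residual X)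
    (hf : ContinuousOn f C) {S : Set H} (hS : IsOpen S) :
    ∃ O : Set (X × G), IsOpen O ∧
      ∀ᶠ p in residual (X × G), p ∈ O ↔ ∃ s ∈ S, f (p.2 • p.1) = s • f p.1 := by
  rcases isEmpty_or_nonempty (Y × S) with hE | hN
  · refine ⟨∅, isOpen_empty, Eventually.of_forall fun p => ?_⟩
    simp only [mem_empty_iff_false, false_iff, not_exists, not_and]
    exact fun s hs _ => hE.elim (f p.1, ⟨s, hs⟩)
  · have := hS.polishSpace
    obtain ⟨π, hπ, hπs⟩ := PolishSpace.exists_nat_nat_continuous_surjective (Y × S)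
    have hψ : Continuous (fun r : Y × S => (r.1, (r.2 : H) • r.1)) := by fun_prop
    have hC' : {p : X × G | p.1 ∈ C ∧ p.2 • p.1 ∈ C} ∈ residual (X × G) :=
      ((tendsto_residual_of_isOpenMap continuous_fst isOpenMap_fst).eventually hC).and
        (tendsto_action_residual.eventually hC)
    have hφ : ContinuousOn (fun p : X × G => (f p.1, f (p.2 • p.1)))
        {p : X × G | p.1 ∈ C ∧ p.2 • p.1 ∈ C} :=
      (hf.comp continuousOn_fst fun p hp => hp.1).prodMk
        (hf.comp (by fun_prop) fun p hp => hp.2)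
    obtain ⟨O, hO, h⟩ := exists_isOpen_eventually_mem_iff hC' hφ (hψ.comp hπ)
    refine ⟨O, hO, ?_⟩
    filter_upwards [h] with p hp
    rw [hp, hπs.range_comp]
    simp only [mem_range, Prod.exists, Prod.mk.injEq, Subtype.exists]
    constructor
    · rintro ⟨_, s, hs, rfl, h⟩
      exact ⟨s, hs, h.symm⟩
    · rintro ⟨s, hs, h⟩
      exact ⟨_, s, hs, rfl, h.symm⟩

variable [IsTopologicalGroup H]

/-- For almost all `(z, h)` with `z ∈ N` and `h ∈ V`, the point `f (h • z)` lies in `W • f z`. -/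
def GenericallyTracks (f : X → Y) (W : Set H) (N : Set X) (V : Set G) : Prop :=
  ∀ᶠ p : X × G in residual (X × G), p.1 ∈ N → p.2 ∈ V → ∃ w ∈ W, f (p.2 • p.1) = w • f p.1

theorem dense_genericallyTracks {f : X → Y} (hom : IsOrbitHom G H f) {C : Set X}
    (hC : C ∈ residual X) (hf : ContinuousOn f C) {W : Set H} (hW : IsOpen W) (hW1 : (1 : H) ∈ W) :
    Dense {x : X | ∃ N : Set X, IsOpen N ∧ x ∈ N ∧ ∃ V : Set G, IsOpen V ∧ (1 : G) ∈ V ∧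
      GenericallyTracks f W N V} := by
  obtain ⟨W', hW'o, hW'1, hW'⟩ : ∃ W' : Set H, IsOpen W' ∧ (1 : H) ∈ W' ∧
      ∀ w ∈ W', ∀ w' ∈ W', w' * w⁻¹ ∈ W := by
    have hcont : Continuous (fun p : H × H => p.2 * p.1⁻¹) := by fun_prop
    have : (fun p : H × H => p.2 * p.1⁻¹) ⁻¹' W ∈ 𝓝 ((1 : H), (1 : H)) :=
      (hW.preimage hcont).mem_nhds (by simpa using hW1)
    rw [nhds_prod_eq, mem_prod_self_iff] at this
    obtain ⟨T, hT, hTW⟩ := this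
    obtain ⟨T', hT', ho, h1⟩ := mem_nhds_iff.1 hT
    exact ⟨T', ho, h1, fun w hw w' hw' => hTW (mk_mem_prod (hT' hw) (hT' hw'))⟩
  -- `O` stands for "`f (h • z) ∈ W • f z`", and `Q n` for "`f (g • x) ∈ W' * b • f x`" with `b` the
  -- `n`-th point of a dense sequence.
  obtain ⟨O, hOo, hO⟩ := exists_isOpen_translates (G := G) hC hf hW
  have hS : ∀ n, IsOpen {a : H | a * (TopologicalSpace.denseSeq H n)⁻¹ ∈ W'} := fun n =>
    hW'o.preimage (by fun_prop)
  choose Q hQo hQ using fun n => exists_isOpen_translates (G := G) hC hf (hS n)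
  have hcover : ∀ᶠ p in residual (X × G), ∃ n, p ∈ Q n := by
    filter_upwards [eventually_countable_forall.2 hQ] with p hp
    obtain ⟨a, ha⟩ : ∃ a : H, a • f p.1 = f (p.2 • p.1) :=
      hom _ _ ⟨p.2, rfl⟩
    have hopen : IsOpen {b : H | a * b⁻¹ ∈ W'} := hW'o.preimage (by fun_prop)
    obtain ⟨n, hn⟩ := (TopologicalSpace.denseRange_denseSeq H).exists_mem_open hopen
      ⟨a, by simpa using hW'1⟩
    exact ⟨n, (hp n).2 ⟨a, hn, ha.symm⟩⟩
  rw [dense_iff_inter_open]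
  rintro N₀ hN₀ ⟨x₀, hx₀⟩
  have hact : Continuous (fun p : X × G => p.2 • p.1) := by fun_prop
  obtain ⟨⟨x₁, g₁⟩, hxN, n, hn⟩ := (dense_of_mem_residual hcover).inter_open_nonempty
    _ (hN₀.preimage hact) ⟨(x₀, 1), by simpa using hx₀⟩
  obtain ⟨N, V', hN, hV', hxN', hgV', hsub⟩ := isOpen_prod_iff.1 (hQo n) x₁ g₁ hn
  obtain ⟨V, V'', hV, hV'', h1V, hgV'', hVV⟩ : ∃ V V'' : Set G, IsOpen V ∧ IsOpen V'' ∧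
      (1 : G) ∈ V ∧ g₁ ∈ V'' ∧ ∀ h ∈ V, ∀ g ∈ V'', h * g ∈ V' := by
    have hcont : Continuous (fun p : G × G => p.1 * p.2) := by fun_prop
    obtain ⟨V, V'', h1, h2, h3, h4, h5⟩ := isOpen_prod_iff.1 (hV'.preimage hcont) 1 g₁
      (by simpa using hgV')
    exact ⟨V, V'', h1, h2, h3, h4, fun h hh g hg => h5 (mk_mem_prod hh hg)⟩
  refine ⟨g₁ • x₁, hxN, (fun p : X × G => p.2 • p.1) '' N ×ˢ (V' ∩ V''),
    isOpenMap_action _ (hN.prod (hV'.inter hV'')), ⟨(x₁, g₁), ⟨hxN', hgV', hgV''⟩, rfl⟩,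
    V, hV, h1V, ?_⟩
  have hdense : ∀ z ∈ (fun p : X × G => p.2 • p.1) '' N ×ˢ (V' ∩ V''), ∀ h ∈ V,
      (z, h) ∈ closure O := by
    rintro _ ⟨⟨x, g⟩, ⟨hx, hg', hg''⟩, rfl⟩ h hh
    rw [mem_closure_iff]
    intro R hR hzR
    -- Writing `z = g • x`, genericity is taken in the triple `(x, g, h)`: the maps to `(g • x, h)`,
    -- `(x, g)` and `(x, h * g)` are continuous and open, so the generic descriptions of `O` and `Q
    -- n` all pull back.
    have hcR : Continuous (fun p : (X × G) × G => (p.1.2 • p.1.1, p.2)) := by fun_prop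
    have hoR : IsOpenMap (fun p : (X × G) × G => (p.1.2 • p.1.1, p.2)) :=
      isOpenMap_action.prodMap IsOpenMap.id
    have hcT : Continuous (fun p : (X × G) × G => (p.1.1, p.2 * p.1.2)) := by fun_prop
    have hoT : IsOpenMap (fun p : (X × G) × G => (p.1.1, p.2 * p.1.2)) :=
      (IsOpenMap.id.prodMap (isOpenMap_action (G := G) (X := G))).comp
        (Homeomorph.prodAssoc X G G).isOpenMap
    have hgen : ∀ᶠ p : (X × G) × G in residual ((X × G) × G),
        ((p.1.2 • p.1.1, p.2) ∈ O ↔ ∃ w ∈ W, f (p.2 • p.1.2 • p.1.1) = w • f (p.1.2 • p.1.1)) ∧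
        (p.1 ∈ Q n ↔ ∃ s : H, s * (TopologicalSpace.denseSeq H n)⁻¹ ∈ W' ∧
          f (p.1.2 • p.1.1) = s • f p.1.1) ∧
        ((p.1.1, p.2 * p.1.2) ∈ Q n ↔ ∃ s : H, s * (TopologicalSpace.denseSeq H n)⁻¹ ∈ W' ∧
          f ((p.2 * p.1.2) • p.1.1) = s • f p.1.1) :=
      ((tendsto_residual_of_isOpenMap hcR hoR).eventually hO).and
        (((tendsto_residual_of_isOpenMap continuous_fst isOpenMap_fst).eventually (hQ n)).and
          ((tendsto_residual_of_isOpenMap hcT hoT).eventually (hQ n)))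
    obtain ⟨⟨⟨x', g'⟩, h'⟩, ⟨⟨⟨hx', hg1, hg2⟩, hh'⟩, hR'⟩, hp1, hp2, hp3⟩ :=
      (dense_of_mem_residual hgen).inter_open_nonempty
        (((N ×ˢ (V' ∩ V'')) ×ˢ V) ∩ (fun p : (X × G) × G => (p.1.2 • p.1.1, p.2)) ⁻¹' R)
        (((hN.prod (hV'.inter hV'')).prod hV).inter (hR.preimage hcR))
        ⟨((x, g), h), ⟨⟨hx, hg', hg''⟩, hh⟩, hzR⟩
    dsimp only at *
    refine ⟨_, hR', hp1.2 ?_⟩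
    obtain ⟨s, hs, hse⟩ := hp2.1 (hsub (mk_mem_prod hx' hg1))
    obtain ⟨t, ht, hte⟩ := hp3.1 (hsub (mk_mem_prod hx' (hVV h' hh' g' hg2)))
    refine ⟨t * s⁻¹, ?_, ?_⟩
    · have := hW' _ hs _ ht
      simpa [mul_assoc] using this
    · rw [hse, ← mul_smul, ← mul_smul, hte]
      simp
  -- An open set is comeager in its closure, so density of `O` in the box suffices.
  filter_upwards [hO, (closure_residualEq hOo.isLocallyClosed).mem_iff] with p hp1 hp2 hpN hpV
  exact hp1.1 (hp2.1 (hdense _ hpN _ hpV))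

/-- `f` maps a step `z ↦ h • z` with `h ∈ V` inside `C ∩ N` to a step by an element of `W`. -/
def Tracks (f : X → Y) (C : Set X) (W : Set H) (N : Set X) (V : Set G) : Prop :=
  ∀ z ∈ C ∩ N, ∀ h ∈ V, h • z ∈ C ∩ N → ∃ w ∈ W, f (h • z) = w • f z

/-- Generic tracking gives tracking for every pair `z`, `h • z` of good points: a generic small `k`
tracks both from `z` to `k • h • z` and from `h • z` to `k • h • z`, so `f z` and `f (h • z)` are
compared through `f (k • h • z)`, at the cost of replacing `W` by `W⁻¹ * W`. -/
theorem exists_comeager_tracks {f : X → Y} (hf : BaireMeasurable f) (hom : IsOrbitHom G H f) :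
    ∃ C ∈ residual X, ContinuousOn f C ∧ ∀ W ∈ 𝓝 (1 : H), ∀ x ∈ C,
      ∃ N ∈ 𝓝 x, ∃ V ∈ 𝓝 (1 : G), Tracks f C W N V := by
  obtain ⟨C₀, hC₀, hfC₀⟩ := hf.exists_continuousOn
  let BX := TopologicalSpace.countableBasis X
  let BG := TopologicalSpace.countableBasis G
  let BH := TopologicalSpace.countableBasis H
  have hcX : BX.Countable := TopologicalSpace.countable_countableBasis X
  have hcG : BG.Countable := TopologicalSpace.countable_countableBasis G
  have hcH : BH.Countable := TopologicalSpace.countable_countableBasis H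
  have hbX : TopologicalSpace.IsTopologicalBasis BX := TopologicalSpace.isBasis_countableBasis X
  have hbG : TopologicalSpace.IsTopologicalBasis BG := TopologicalSpace.isBasis_countableBasis G
  have hbH : TopologicalSpace.IsTopologicalBasis BH := TopologicalSpace.isBasis_countableBasis H
  let good : X → Prop := fun x => x ∈ C₀ ∧ ∀ W ∈ BH, (1 : H) ∈ W →
    (∃ N : Set X, IsOpen N ∧ x ∈ N ∧ ∃ V : Set G, IsOpen V ∧ (1 : G) ∈ V ∧
      GenericallyTracks f W N V) ∧
    ∀ N ∈ BX, ∀ V ∈ BG, GenericallyTracks f W N V →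
      ∀ᶠ h in residual G, x ∈ N → h ∈ V → ∃ w ∈ W, f (h • x) = w • f x
  have hgood : ∀ᶠ x in residual X, good x := by
    refine Eventually.and hC₀ ?_
    rw [eventually_countable_ball hcH]
    intro W hW
    by_cases h1 : (1 : H) ∈ W
    · simp only [h1, forall_true_left]
      refine Eventually.and ?_ ?_
      · refine residual_of_dense_open (s := {x : X | ∃ N : Set X, IsOpen N ∧ x ∈ N ∧ ∃ V : Set G,
          IsOpen V ∧ (1 : G) ∈ V ∧ GenericallyTracks f W N V}) ?_
          (dense_genericallyTracks hom hC₀ hfC₀ (hbH.isOpen hW) h1)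
        rw [isOpen_iff_forall_mem_open]
        rintro x ⟨N, hN, hxN, h⟩
        exact ⟨N, fun x' hx' => ⟨N, hN, hx', h⟩, hN, hxN⟩
      · rw [eventually_countable_ball hcX]
        intro N _
        rw [eventually_countable_ball hcG]
        intro V _
        by_cases ht : GenericallyTracks f W N V
        · filter_upwards [eventually_residual_section ht] with x hx _
          exact hx
        · exact Eventually.of_forall fun x h => absurd h ht
    · exact Eventually.of_forall fun x h => absurd h h1
  refine ⟨{x | good x}, hgood, hfC₀.mono fun x hx => hx.1, ?_⟩
  intro Ŵ hŴ x hx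
  obtain ⟨W, hWB, hW1, hW⟩ : ∃ W ∈ BH, (1 : H) ∈ W ∧ ∀ w ∈ W, ∀ w' ∈ W, w⁻¹ * w' ∈ Ŵ := by
    have hcont : ContinuousAt (fun p : H × H => p.1⁻¹ * p.2) (1, 1) :=
      Continuous.continuousAt (by fun_prop)
    have : (fun p : H × H => p.1⁻¹ * p.2) ⁻¹' Ŵ ∈ 𝓝 ((1 : H), (1 : H)) :=
      hcont.preimage_mem_nhds (by simpa using hŴ)
    rw [nhds_prod_eq, mem_prod_self_iff] at this
    obtain ⟨T, hT, hTW⟩ := this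
    obtain ⟨W, hW, h1, hWT⟩ := hbH.mem_nhds_iff.1 hT
    exact ⟨W, hW, h1, fun w hw w' hw' => hTW (mk_mem_prod (hWT hw) (hWT hw'))⟩
  obtain ⟨N₀, hN₀, hxN₀, V₀, hV₀, h1V₀, hT₀⟩ := (hx.2 W hWB hW1).1
  obtain ⟨N, hN, hxN, hNN₀⟩ := hbX.exists_subset_of_mem_open hxN₀ hN₀
  obtain ⟨V, hV, h1V, hVV₀⟩ := hbG.exists_subset_of_mem_open h1V₀ hV₀
  have hT : GenericallyTracks f W N V := by
    filter_upwards [hT₀] with p hp hpN hpV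
    exact hp (hNN₀ hpN) (hVV₀ hpV)
  obtain ⟨V₁, hV₁, h1V₁, hVV⟩ : ∃ V₁ : Set G, IsOpen V₁ ∧ (1 : G) ∈ V₁ ∧
      ∀ g ∈ V₁, ∀ h ∈ V₁, g * h ∈ V := by
    have hcont : Continuous (fun p : G × G => p.1 * p.2) := by fun_prop
    have : (fun p : G × G => p.1 * p.2) ⁻¹' V ∈ 𝓝 ((1 : G), (1 : G)) :=
      ((hbG.isOpen hV).preimage hcont).mem_nhds (by simpa using h1V)
    rw [nhds_prod_eq, mem_prod_self_iff] at this
    obtain ⟨T, hT, hTW⟩ := this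
    obtain ⟨T', hT', ho, h1⟩ := mem_nhds_iff.1 hT
    exact ⟨T', ho, h1, fun w hw w' hw' => hTW (mk_mem_prod (hT' hw) (hT' hw'))⟩
  refine ⟨N, (hbX.isOpen hN).mem_nhds hxN, V₁, hV₁.mem_nhds h1V₁, ?_⟩
  rintro z ⟨hz, hzN⟩ h hh ⟨hhz, hhzN⟩
  have e1 := (hz.2 W hWB hW1).2 N hN V hV hT
  have e2 := (hhz.2 W hWB hW1).2 N hN V hV hT
  have hmul : Tendsto (fun k : G => k * h) (residual G) (residual G) :=
    tendsto_residual_of_isOpenMap (by fun_prop) (isOpenMap_mul_right h)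
  obtain ⟨k, hk, k1, k2⟩ := (dense_of_mem_residual ((hmul.eventually e1).and e2)).inter_open_nonempty
    V₁ hV₁ ⟨1, h1V₁⟩
  obtain ⟨w, hw, hwe⟩ := k1 hzN (hVV k hk h hh)
  obtain ⟨w', hw', hwe'⟩ := k2 hhzN (by simpa using hVV k hk 1 h1V₁)
  refine ⟨w'⁻¹ * w, hW _ hw' _ hw, ?_⟩
  rw [mul_smul, ← hwe, mul_smul, hwe', inv_smul_smul]

end OrbitContinuity

/-! ### Positions, strategies and invariant sets -/

/-- A position before a turn: Odd is about to play a neighborhood of `fixed`, and Eve is about to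
move the point `moving` by steps from `grp` inside `nbhd`. -/
structure Position (G : Type*) (X : Type*) where
  fixed : X
  moving : X
  grp : Set G
  nbhd : Set X
  rank : Ordinal.{0}

section Game

variable {G X : Type*} [Group G] [MulAction G X]

namespace Position

/-- The position after Odd plays `m` and Eve replies with `g`. -/
def next (s : Position G X) (m : OddMove G X) (g : G) : Position G X :=
  ⟨g • s.moving, s.fixed, m.grp, m.nbhd, m.rank⟩

/-- The initial position of `Appr_α(x, y)`. -/
def start (G : Type*) {X : Type*} (α : Ordinal.{0}) (x y : X) : Position G X :=
  ⟨x, y, univ, univ, α⟩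

/-- Odd may play `m` at `s`. -/
def Legal [TopologicalSpace G] [TopologicalSpace X] (s : Position G X) (m : OddMove G X) : Prop :=
  Passes {W : Set G | IsOpen W ∧ (1 : G) ∈ W} s.grp s.rank m.grp m.rank ∧
    IsOpen m.nbhd ∧ s.fixed ∈ m.nbhd

/-- The reply `g` to `m` fulfils the demands on Eve in this turn. -/
def Answers [TopologicalSpace X] (s : Position G X) (m : OddMove G X) (g : G) : Prop :=
  Reaches s.grp s.nbhd s.moving g ∧ g • s.moving ∈ closure m.nbhd

/-- The positions along a play. -/
def along (s : Position G X) (odd : ℕ → OddMove G X) (eve : ℕ → G) : ℕ → Position G X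
  | 0 => s
  | t + 1 => (along s odd eve t).next (odd t) (eve t)

theorem along_congr (s : Position G X) {odd odd' : ℕ → OddMove G X} {eve eve' : ℕ → G} {t : ℕ}
    (ho : ∀ i < t, odd i = odd' i) (he : ∀ i < t, eve i = eve' i) :
    s.along odd eve t = s.along odd' eve' t := by
  induction t with
  | zero => rfl
  | succ t ih =>
    simp only [along]
    rw [ih (fun i hi => ho i (by omega)) (fun i hi => he i (by omega)), ho t (by omega),
      he t (by omega)]

theorem along_start (α : Ordinal.{0}) (x y : X) (odd : ℕ → OddMove G X) (eve : ℕ → G) (n : ℕ) :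
    (start G α x y).along odd eve (2 * n) =
        ⟨xPt x eve n, yPt y eve n, yGrp univ odd n, ySet univ odd n, rk α odd (2 * n)⟩ ∧
      (start G α x y).along odd eve (2 * n + 1) =
        ⟨yPt y eve (n + 1), xPt x eve n, xGrp odd n, xSet odd n, rk α odd (2 * n + 1)⟩ := by
  have step : ∀ n, (start G α x y).along odd eve (2 * n) =
        ⟨xPt x eve n, yPt y eve n, yGrp univ odd n, ySet univ odd n, rk α odd (2 * n)⟩ →
      (start G α x y).along odd eve (2 * n + 1) =
        ⟨yPt y eve (n + 1), xPt x eve n, xGrp odd n, xSet odd n, rk α odd (2 * n + 1)⟩ := by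
    intro n h
    rw [along, h]
    rfl
  induction n with
  | zero => exact ⟨rfl, step 0 rfl⟩
  | succ n ih =>
    have h : (start G α x y).along odd eve (2 * (n + 1)) = ⟨xPt x eve (n + 1), yPt y eve (n + 1),
        yGrp univ odd (n + 1), ySet univ odd (n + 1), rk α odd (2 * (n + 1))⟩ := by
      rw [show 2 * (n + 1) = (2 * n + 1) + 1 by ring, along, ih.2]
      rfl
    exact ⟨h, step _ h⟩

end Position

theorem forall_even_odd {p : ℕ → Prop} : (∀ t, p t) ↔ ∀ n, p (2 * n) ∧ p (2 * n + 1) := by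
  refine ⟨fun h n => ⟨h _, h _⟩, fun h t => ?_⟩
  obtain ⟨n, rfl | rfl⟩ := t.even_or_odd'
  exacts [(h n).1, (h n).2]

theorem oddLegal_iff [TopologicalSpace G] [TopologicalSpace X] {α : Ordinal.{0}} {x y : X}
    {odd : ℕ → OddMove G X} {eve : ℕ → G} :
    OddLegal α x y {W : Set G | IsOpen W ∧ (1 : G) ∈ W} univ odd eve ↔
      ∀ t, ((Position.start G α x y).along odd eve t).Legal (odd t) := by
  rw [forall_even_odd]
  refine forall_congr' fun n => ?_
  rw [(Position.along_start α x y odd eve n).1, (Position.along_start α x y odd eve n).2]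
  rfl

theorem eveWins_iff [TopologicalSpace X] (α : Ordinal.{0}) {x y : X}
    {odd : ℕ → OddMove G X} {eve : ℕ → G} :
    EveWins x y univ univ odd eve ↔
      ∀ t, ((Position.start G α x y).along odd eve t).Answers (odd t) (eve t) := by
  rw [forall_even_odd]
  have h : ∀ n, (((Position.start G α x y).along odd eve (2 * n)).Answers (odd (2 * n))
        (eve (2 * n)) ∧ ((Position.start G α x y).along odd eve (2 * n + 1)).Answers
        (odd (2 * n + 1)) (eve (2 * n + 1))) ↔
      (Reaches (yGrp univ odd n) (ySet univ odd n) (yPt y eve n) (eve (2 * n)) ∧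
        yPt y eve (n + 1) ∈ closure (xSet odd n)) ∧
      (Reaches (xGrp odd n) (xSet odd n) (xPt x eve n) (eve (2 * n + 1)) ∧
        xPt x eve (n + 1) ∈ closure (ySet univ odd (n + 1))) := by
    intro n
    rw [(Position.along_start α x y odd eve n).1, (Position.along_start α x y odd eve n).2]
    rfl
  simp only [h]
  constructor
  · intro hw n
    exact ⟨⟨(hw n).2.2.1, (hw n).1⟩, (hw n).2.2.2, (hw (n + 1)).2.1⟩
  · intro hw n
    refine ⟨(hw n).1.2, ?_, (hw n).1.1, (hw n).2.1⟩
    cases n with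
    | zero => simp [ySet]
    | succ n => exact (hw n).2.2

/-- Positions along the play in which Eve answers according to `r`. -/
noncomputable def followed (r : Position G X → OddMove G X → G) (s : Position G X)
    (odd : ℕ → OddMove G X) : ℕ → Position G X
  | 0 => s
  | t + 1 => (followed r s odd t).next (odd t) (r (followed r s odd t) (odd t))

theorem followed_congr (r : Position G X → OddMove G X → G) (s : Position G X)
    {odd odd' : ℕ → OddMove G X} {t : ℕ} (h : ∀ i < t, odd i = odd' i) :
    followed r s odd t = followed r s odd' t := by
  induction t with
  | zero => rfl
  | succ t ih =>
    simp only [followed]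
    rw [ih fun i hi => h i (by omega), h t (by omega)]

variable [TopologicalSpace G] [TopologicalSpace X]

/-- From each position in `I`, Eve can answer each legal move of Odd and stay in `I`. -/
def Sustains (I : Set (Position G X)) : Prop :=
  ∀ s ∈ I, ∀ m, s.Legal m → ∃ g, s.Answers m g ∧ s.next m g ∈ I

/-- A position determines which moves are legal and which replies are adequate, so answers chosen
position by position form a strategy. -/
theorem Sustains.sim {I : Set (Position G X)} (hI : Sustains I) {α : Ordinal.{0}} {x y : X}
    (hs : Position.start G α x y ∈ I) : Sim G α x y := by
  have h1 : ∀ (s : Position G X) (m : OddMove G X), ∃ g : G,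
      s ∈ I → s.Legal m → s.Answers m g ∧ s.next m g ∈ I := by
    intro s m
    by_cases h : s ∈ I ∧ s.Legal m
    · obtain ⟨g, hg⟩ := hI s h.1 m h.2
      exact ⟨g, fun _ _ => hg⟩
    · exact ⟨1, fun h1 h2 => absurd ⟨h1, h2⟩ h⟩
  choose r hr using h1
  let s₀ := Position.start G α x y
  -- The padding value is irrelevant: the position before move `t` depends only on earlier moves.
  let ext : (t : ℕ) → (Fin (t + 1) → OddMove G X) → ℕ → OddMove G X := fun t p i =>
    if h : i < t + 1 then p ⟨i, h⟩ else p 0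
  let σ : Strategy G X := fun t p => r (followed r s₀ (ext t p) t) (p (Fin.last t))
  refine ⟨σ, fun odd hodd => ?_⟩
  have hσ : ∀ t, σ.replies odd t = r (followed r s₀ odd t) (odd t) := by
    intro t
    change r (followed r s₀ (ext t fun i => odd i) t) (odd t) = _
    rw [followed_congr r s₀ (odd' := odd)]
    intro i hi
    simp only [ext, dif_pos (show i < t + 1 by omega)]
  have halong : ∀ t, s₀.along odd (σ.replies odd) t = followed r s₀ odd t := by
    intro t
    induction t with
    | zero => rfl
    | succ t ih => rw [Position.along, followed, ih, hσ]
  rw [oddLegal_iff] at hodd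
  rw [eveWins_iff α]
  have hmem : ∀ t, s₀.along odd (σ.replies odd) t ∈ I := by
    intro t
    induction t with
    | zero => exact hs
    | succ t ih =>
      rw [Position.along, hσ, ← halong]
      exact (hr _ _ ih (hodd t)).2
  intro t
  have := (hr _ _ (hmem t) (hodd t)).1
  rwa [halong, ← hσ, ← halong] at this

theorem Sim.exists_sustains {α : Ordinal.{0}} {x y : X} (h : Sim G α x y) :
    ∃ I : Set (Position G X), Sustains I ∧ Position.start G α x y ∈ I := by
  obtain ⟨σ, hσ⟩ := h
  let s₀ := Position.start G α x y
  have hext : ∀ (odd : ℕ → OddMove G X) (t : ℕ),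
      (∀ i < t, (s₀.along odd (σ.replies odd) i).Legal (odd i)) →
      ∀ m, (s₀.along odd (σ.replies odd) t).Legal m → ∃ odd' : ℕ → OddMove G X,
        (∀ i < t, odd' i = odd i) ∧ odd' t = m ∧
        ∀ i, (s₀.along odd' (σ.replies odd') i).Legal (odd' i) := by
    intro odd t hodd m hm
    -- A strategy is only tested on infinite legal plays, so after `m` Odd passes forever: he keeps
    -- the group and ordinal of `m` and plays the whole space.
    let odd' : ℕ → OddMove G X := fun i =>
      if i < t then odd i else if i = t then m else ⟨univ, m.grp, m.rank⟩
    have h1 : ∀ i < t, odd' i = odd i := fun i hi => if_pos hi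
    have h2 : odd' t = m := by simp [odd']
    have h3 : ∀ i, t < i → odd' i = ⟨univ, m.grp, m.rank⟩ := fun i hi => by
      simp only [odd', if_neg (show ¬ i < t by omega), if_neg (show ¬ i = t by omega)]
    have hrep : ∀ i < t, σ.replies odd' i = σ.replies odd i := by
      intro i hi
      simp only [Strategy.replies]
      congr 1
      funext j
      exact h1 j (by omega)
    have hal : ∀ i ≤ t, s₀.along odd' (σ.replies odd') i = s₀.along odd (σ.replies odd) i :=
      fun i hi => Position.along_congr _ (fun j hj => h1 j (by omega))
        fun j hj => hrep j (by omega)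
    have hgr : ∀ i, t ≤ i → (odd' i).grp = m.grp ∧ (odd' i).rank = m.rank := by
      intro i hi
      rcases hi.eq_or_lt with rfl | hi
      · simp [h2]
      · simp [h3 i hi]
    refine ⟨odd', h1, h2, fun i => ?_⟩
    rcases lt_trichotomy i t with hi | rfl | hi
    · rw [hal i hi.le, h1 i hi]
      exact hodd i hi
    · rw [hal i le_rfl, h2]
      exact hm
    · obtain ⟨j, rfl⟩ : ∃ j, i = j + 1 := ⟨i - 1, by omega⟩
      rw [h3 _ hi]
      refine ⟨Or.inl ?_, isOpen_univ, mem_univ _⟩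
      exact ⟨(hgr j (by omega)).1.symm, (hgr j (by omega)).2.symm⟩
  have hwin : ∀ odd : ℕ → OddMove G X, (∀ i, (s₀.along odd (σ.replies odd) i).Legal (odd i)) →
      ∀ t, (s₀.along odd (σ.replies odd) t).Answers (odd t) (σ.replies odd t) := fun odd h =>
    (eveWins_iff α).1 (hσ odd (oddLegal_iff.2 h))
  refine ⟨{s | ∃ (odd : ℕ → OddMove G X) (t : ℕ),
    (∀ i < t, (s₀.along odd (σ.replies odd) i).Legal (odd i)) ∧
      s = s₀.along odd (σ.replies odd) t}, ?_,
    ⟨fun _ => ⟨univ, univ, 0⟩, 0, fun i hi => absurd hi (Nat.not_lt_zero i), rfl⟩⟩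
  rintro _ ⟨odd, t, hodd, rfl⟩ m hm
  obtain ⟨odd', h1, h2, h3⟩ := hext odd t hodd m hm
  have hal : s₀.along odd' (σ.replies odd') t = s₀.along odd (σ.replies odd) t := by
    refine Position.along_congr _ h1 fun i hi => ?_
    simp only [Strategy.replies]
    congr 1
    funext j
    exact h1 j (by omega)
  refine ⟨σ.replies odd' t, ?_, odd', t + 1, fun i _ => h3 i, ?_⟩
  · rw [← hal, ← h2]
    exact hwin odd' h3 t
  · rw [Position.along, hal, h2]

/-- The second point may be replaced by any other point of its orbit. -/
theorem Sim.smul_right {α : Ordinal.{0}} {x y : X} (h : Sim G α x y) (d : G) :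
    Sim G α x (d • y) := by
  obtain ⟨I, hI, hs⟩ := h.exists_sustains
  refine Sustains.sim (I := insert (Position.start G α x (d • y)) I) ?_ (mem_insert _ _)
  rintro s (rfl | hsI) m hm
  · obtain ⟨g, hg, hgI⟩ := hI _ hs m hm
    -- Eve's first reply is a single unrestricted step, so she can undo `d` before answering as in
    -- the original game.
    refine ⟨g * d⁻¹, ⟨⟨0, fun _ => g * d⁻¹, rfl, fun _ _ => mem_univ _, fun _ _ => mem_univ _⟩, ?_⟩,
      mem_insert_of_mem _ ?_⟩
    · simpa [Position.start, mul_smul] using hg.2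
    · simpa [Position.start, Position.next, mul_smul] using hgI
  · obtain ⟨g, hg, hgI⟩ := hI s hsI m hm
    exact ⟨g, hg, mem_insert_of_mem _ hgI⟩

end Game

/-! ### Reduction to countably many moves and points -/

theorem countable_Iic_of_lt_omega_one {α : Ordinal.{0}} (hα : α < Ordinal.omega 1) :
    (Iic α).Countable := by
  have h : (Iio α).Countable := by
    rw [← Cardinal.ord_aleph, Cardinal.lt_ord, ← Cardinal.succ_aleph0, Order.lt_succ_iff] at hα
    rw [← Cardinal.le_aleph0_iff_set_countable, Cardinal.mk_Iio_ordinal]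
    rw [Cardinal.lift_le_aleph0]
    exact hα
  rw [← Iio_insert]
  exact h.insert α

/-- The groups of the moves in `basicMoves`. -/
def basicGroups (G : Type*) [TopologicalSpace G] [SecondCountableTopology G] : Set (Set G) :=
  insert univ (TopologicalSpace.countableBasis G)

/-- Moves of Odd with sets from fixed countable bases. -/
def basicMoves (G X : Type*) [TopologicalSpace G] [SecondCountableTopology G] [TopologicalSpace X]
    [SecondCountableTopology X] (α : Ordinal.{0}) : Set (OddMove G X) :=
  {m | m.nbhd ∈ TopologicalSpace.countableBasis X ∧ m.grp ∈ basicGroups G ∧ m.rank ≤ α}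

theorem countable_basicMoves {G X : Type*} [TopologicalSpace G] [SecondCountableTopology G]
    [TopologicalSpace X] [SecondCountableTopology X] {α : Ordinal.{0}} (hα : α < Ordinal.omega 1) :
    (basicMoves G X α).Countable := by
  refine Countable.mono ?_ (((TopologicalSpace.countable_countableBasis X).prod
    (((TopologicalSpace.countable_countableBasis G).insert univ).prod
      (countable_Iic_of_lt_omega_one hα))).image
    fun p : Set X × Set G × Ordinal.{0} => (⟨p.1, p.2.1, p.2.2⟩ : OddMove G X))
  exact fun m hm => ⟨(m.nbhd, m.grp, m.rank), mk_mem_prod hm.1 (mk_mem_prod hm.2.1 hm.2.2), rfl⟩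

section Core

variable {G X : Type*} [Group G] [TopologicalSpace G] [MulAction G X] [TopologicalSpace X]

/-- From each position in `J`, each legal move of Odd in `M` can be answered by a path with all its
points in `Z` so that the play stays in `J`. -/
def SustainsThrough (M : Set (OddMove G X)) (Z : Set X) (J : Set (Position G X)) : Prop :=
  ∀ s ∈ J, ∀ m ∈ M, s.Legal m → ∃ (k : ℕ) (h : ℕ → G),
    (∀ i ≤ k, h i ∈ s.grp ∧ leftProd h i • s.moving ∈ s.nbhd ∩ Z) ∧
    leftProd h k • s.moving ∈ closure m.nbhd ∧ s.next m (leftProd h k) ∈ J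

/-- Fix one answering path for each position and move, and close `s₀` under the answers: finite
sequences of moves from a countable set reach countably many positions, and each path adds countably
many points. -/
theorem exists_countable_sustainsThrough {M : Set (OddMove G X)} (hM : M.Countable)
    {I : Set (Position G X)}
    (hI : ∀ s ∈ I, ∀ m ∈ M, s.Legal m → ∃ g, s.Answers m g ∧ s.next m g ∈ I)
    {s₀ : Position G X} (hs₀ : s₀ ∈ I) {D : Set X} (hD : ∀ (g : G), ∀ x ∈ D, g • x ∈ D)
    (hID : ∀ s ∈ I, s.fixed ∈ D ∧ s.moving ∈ D) :
    ∃ J ⊆ I, s₀ ∈ J ∧ ∃ Z ⊆ D, Z.Countable ∧ (∀ s ∈ J, s.fixed ∈ Z ∧ s.moving ∈ Z) ∧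
      SustainsThrough M Z J := by
  classical
  have h1 : ∀ (s : Position G X) (m : OddMove G X), ∃ (k : ℕ) (h : ℕ → G),
      s ∈ I ∧ m ∈ M ∧ s.Legal m → (∀ i ≤ k, h i ∈ s.grp ∧ leftProd h i • s.moving ∈ s.nbhd) ∧
        leftProd h k • s.moving ∈ closure m.nbhd ∧ s.next m (leftProd h k) ∈ I := by
    intro s m
    by_cases hsm : s ∈ I ∧ m ∈ M ∧ s.Legal m
    · obtain ⟨_, ⟨⟨k, h, rfl, hg, hn⟩, hc⟩, hJ⟩ := hI s hsm.1 m hsm.2.1 hsm.2.2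
      exact ⟨k, h, fun _ => ⟨fun i hi => ⟨hg i hi, hn i hi⟩, hc, hJ⟩⟩
    · exact ⟨0, fun _ => 1, fun h => absurd h hsm⟩
  choose k h hkh using h1
  let step : Position G X → M → Position G X := fun s m =>
    if s ∈ I ∧ m.1 ∈ M ∧ s.Legal m then s.next m (leftProd (h s m) (k s m)) else s
  have hstep : ∀ s ∈ I, ∀ m, step s m ∈ I := by
    intro s hs m
    by_cases hsm : s ∈ I ∧ m.1 ∈ M ∧ s.Legal m
    · simp only [step, if_pos hsm]
      exact (hkh s m hsm).2.2
    · simpa only [step, if_neg hsm] using hs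
  have := hM.to_subtype
  let J : Set (Position G X) := range fun l : List M => l.foldl step s₀
  have hJc : J.Countable := countable_range _
  have hJI : J ⊆ I := by
    rintro _ ⟨l, rfl⟩
    induction l using List.reverseRecOn with
    | nil => exact hs₀
    | append_singleton l m ih =>
      simp only [List.foldl_append, List.foldl_cons, List.foldl_nil]
      exact hstep _ ih m
  let Z : Set X := ⋃ s ∈ J, ({s.fixed, s.moving} ∪
    ⋃ m ∈ M, range fun i => leftProd (h s m) i • s.moving)
  refine ⟨J, hJI, ⟨[], rfl⟩, Z, ?_, ?_, ?_, ?_⟩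
  · refine iUnion₂_subset fun s hs => union_subset ?_ (iUnion₂_subset fun m _ => ?_)
    · rintro z (rfl | rfl)
      exacts [(hID s (hJI hs)).1, (hID s (hJI hs)).2]
    · rintro _ ⟨i, rfl⟩
      exact hD _ _ (hID s (hJI hs)).2
  · exact hJc.biUnion fun s _ => ((countable_singleton _).insert _).union
      (hM.biUnion fun m _ => countable_range _)
  · exact fun s hs => ⟨mem_biUnion hs (Or.inl (Or.inl rfl)), mem_biUnion hs (Or.inl (Or.inr rfl))⟩
  · intro s hs m hm hl
    have hsm : s ∈ I ∧ m ∈ M ∧ s.Legal m := ⟨hJI hs, hm, hl⟩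
    obtain ⟨h2, h3, -⟩ := hkh s m hsm
    refine ⟨k s m, h s m, fun i hi => ⟨(h2 i hi).1, (h2 i hi).2, ?_⟩, h3, ?_⟩
    · exact mem_biUnion hs (Or.inr (mem_biUnion hm ⟨i, rfl⟩))
    · obtain ⟨l, rfl⟩ := hs
      refine ⟨l ++ [⟨m, hm⟩], ?_⟩
      simp only [List.foldl_append, List.foldl_cons, List.foldl_nil]
      exact if_pos hsm

variable [SecondCountableTopology G] [SecondCountableTopology X]

theorem Sim.exists_countable {α : Ordinal.{0}} (hα : α < Ordinal.omega 1) {x y : X}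
    (h : Sim G α x y) {D : Set X} (hD : ∀ (g : G), ∀ x ∈ D, g • x ∈ D) (hx : x ∈ D) (hy : y ∈ D) :
    ∃ (J : Set (Position G X)) (Z : Set X), Position.start G α x y ∈ J ∧ Z ⊆ D ∧ Z.Countable ∧
      (∀ s ∈ J, (s.fixed ∈ Z ∧ s.moving ∈ Z) ∧ s.grp ∈ basicGroups G ∧ s.rank ≤ α) ∧
      SustainsThrough (basicMoves G X α) Z J := by
  obtain ⟨I, hI, hs⟩ := h.exists_sustains
  obtain ⟨J, hJ, hsJ, Z, hZD, hZ, hJZ, hJM⟩ := exists_countable_sustainsThrough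
    (countable_basicMoves (G := G) (X := X) hα)
    (I := {s ∈ I | (s.fixed ∈ D ∧ s.moving ∈ D) ∧ s.grp ∈ basicGroups G ∧ s.rank ≤ α})
    (by
      rintro s ⟨hsI, ⟨h1, h2⟩, -⟩ m hm hl
      obtain ⟨g, hg, hgI⟩ := hI s hsI m hl
      exact ⟨g, hg, hgI, ⟨hD _ _ h2, h1⟩, hm.2⟩)
    -- The initial group is the whole of `G`, which is why `basicGroups` contains `univ`.
    (s₀ := Position.start G α x y) ⟨hs, ⟨hx, hy⟩, mem_insert _ _, le_rfl⟩ hD (fun s hs => hs.2.1)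
  exact ⟨J, Z, hsJ, hZD, hZ, fun s hs => ⟨hJZ s hs, (hJ hs).2.2⟩, hJM⟩

end Core

/-! ### Copying a strategy along the homomorphism -/

section Transfer

variable {G H X Y : Type*} [Group G] [Group H] [MulAction G X] [MulAction H Y]

/-- A tracked path is mapped to a path. -/
theorem Tracks.exists_path {f : X → Y} {C N : Set X} {W : Set H} {V : Set G}
    (hT : Tracks f C W N V) {z : X} (hz : z ∈ C ∩ N) {k : ℕ} {h : ℕ → G}
    (hh : ∀ i ≤ k, h i ∈ V ∧ leftProd h i • z ∈ C ∩ N) :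
    ∃ w : ℕ → H, ∀ i ≤ k, w i ∈ W ∧ leftProd w i • f z = f (leftProd h i • z) := by
  have h0 : ∃ w : H, w ∈ W ∧ f (h 0 • z) = w • f z :=
    hT z hz (h 0) (hh 0 (Nat.zero_le k)).1 (hh 0 (Nat.zero_le k)).2
  have h1 : ∀ i, ∃ w : H, i + 1 ≤ k →
      w ∈ W ∧ f (leftProd h (i + 1) • z) = w • f (leftProd h i • z) := by
    intro i
    by_cases hi : i + 1 ≤ k
    · have hp := (hh (i + 1) hi).2
      rw [leftProd, mul_smul] at hp
      obtain ⟨w, hw, he⟩ := hT _ (hh i (by omega)).2 _ (hh (i + 1) hi).1 hp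
      refine ⟨w, fun _ => ⟨hw, ?_⟩⟩
      rw [leftProd, mul_smul, he]
    · exact ⟨1, fun h => absurd h hi⟩
  obtain ⟨w₀, hw₀, he₀⟩ := h0
  choose w hw using h1
  refine ⟨fun i => Nat.casesOn i w₀ w, fun i hi => ?_⟩
  induction i with
  | zero => exact ⟨hw₀, he₀.symm⟩
  | succ i ih =>
    refine ⟨(hw i hi).1, ?_⟩
    rw [leftProd, mul_smul, (ih (by omega)).2, (hw i hi).2]

variable [TopologicalSpace G] [TopologicalSpace H] [TopologicalSpace X] [TopologicalSpace Y]
  [SecondCountableTopology G] [SecondCountableTopology X]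

theorem SustainsThrough.sim_map [T3Space X] {f : X → Y} (hom : IsOrbitHom G H f) {C : Set X}
    (hC : Dense C) (hf : ContinuousOn f C)
    (hT : ∀ W ∈ 𝓝 (1 : H), ∀ x ∈ C, ∃ N ∈ 𝓝 x, ∃ V ∈ 𝓝 (1 : G), Tracks f C W N V)
    {α : Ordinal.{0}} {x y : X} {J : Set (Position G X)} {Z : Set X}
    (hs : Position.start G α x y ∈ J) (hZC : Z ⊆ C)
    (hJ : ∀ s ∈ J, (s.fixed ∈ Z ∧ s.moving ∈ Z) ∧ s.grp ∈ basicGroups G ∧ s.rank ≤ α)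
    (hJM : SustainsThrough (basicMoves G X α) Z J) : Sim H α (f x) (f y) := by
  have hbX := TopologicalSpace.isBasis_countableBasis X
  have hbG := TopologicalSpace.isBasis_countableBasis G
  -- Each position in `Y` has a shadow in `J`. The tracking region `N` contains the fixed point too,
  -- so it still serves when the roles swap and Odd keeps his group.
  refine Sustains.sim (I := {r : Position H Y | ∃ s ∈ J, ∃ N : Set X, IsOpen N ∧ s.fixed ∈ N ∧
    s.nbhd ⊆ N ∧ s.moving ∈ s.nbhd ∧ Tracks f C r.grp N s.grp ∧ MapsTo f (s.nbhd ∩ C) r.nbhd ∧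
    r.fixed = f s.fixed ∧ r.moving = f s.moving ∧ r.rank = s.rank}) ?_ ?_
  · rintro ⟨a, b, W, O, β⟩ ⟨s, hsJ, N, hN, haN, hnN, hbn, htr, hmap, rfl, rfl, rfl⟩ m
      ⟨hpass, hmo, ham⟩
    dsimp only at htr hmap hpass ham
    have haC : s.fixed ∈ C := hZC (hJ s hsJ).1.1
    have hbC : s.moving ∈ C := hZC (hJ s hsJ).1.2
    obtain ⟨N₁, hN₁, haN₁, V₁, hV₁, htr₁, hpass₁, hrank⟩ : ∃ N₁ : Set X, IsOpen N₁ ∧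
        s.fixed ∈ N₁ ∧ ∃ V₁ ∈ basicGroups G, Tracks f C m.grp N₁ V₁ ∧
        Passes {W : Set G | IsOpen W ∧ (1 : G) ∈ W} s.grp s.rank V₁ m.rank ∧ m.rank ≤ α := by
      rcases hpass with ⟨hg, hr⟩ | ⟨⟨hgo, hg1⟩, hr⟩
      · exact ⟨N, hN, haN, s.grp, (hJ s hsJ).2.1, hg ▸ htr, Or.inl ⟨rfl, hr⟩,
          hr ▸ (hJ s hsJ).2.2⟩
      · obtain ⟨N', hN', V', hV', ht⟩ := hT m.grp (hgo.mem_nhds hg1) _ haC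
        obtain ⟨N₁, hN₁', hN₁, haN₁⟩ := mem_nhds_iff.1 hN'
        obtain ⟨V₁, hV₁, h1V₁, hVV⟩ := hbG.mem_nhds_iff.1 hV'
        refine ⟨N₁, hN₁, haN₁, V₁, mem_insert_of_mem _ hV₁, ?_,
          Or.inr ⟨⟨hbG.isOpen hV₁, h1V₁⟩, hr⟩, hr.le.trans (hJ s hsJ).2.2⟩
        exact fun z hz h hh hhz => ht z ⟨hz.1, hN₁' hz.2⟩ h (hVV hh) ⟨hhz.1, hN₁' hhz.2⟩
    obtain ⟨O', hO', haO', hO'm⟩ := mem_nhdsWithin.1 (hf _ haC (hmo.mem_nhds ham))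
    -- Eve's endpoint is only known to lie in the closure of `U`, so that closure must lie in `N₁`,
    -- where the endpoint becomes the next fixed point.
    obtain ⟨U, hU, haU, hUcl⟩ := hbX.exists_closure_subset
      ((hN₁.inter hO').mem_nhds ⟨haN₁, haO'⟩)
    have hUo := hbX.isOpen hU
    obtain ⟨k, h, hpath, hcl, hnext⟩ := hJM s hsJ ⟨U, V₁, m.rank⟩ ⟨hU, hV₁, hrank⟩
      ⟨hpass₁, hUo, haU⟩
    obtain ⟨w, hw⟩ := htr.exists_path ⟨hbC, hnN hbn⟩
      (fun i hi => ⟨(hpath i hi).1, hZC (hpath i hi).2.2, hnN (hpath i hi).2.1⟩)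
    have hkC : leftProd h k • s.moving ∈ C := hZC (hpath k le_rfl).2.2
    have hUm : MapsTo f (U ∩ C) m.nbhd := fun z hz =>
      hO'm ⟨(hUcl (subset_closure hz.1)).2, hz.2⟩
    refine ⟨leftProd w k, ⟨⟨k, w, rfl, fun i hi => (hw i hi).1, fun i hi => ?_⟩, ?_⟩, ?_⟩
    · dsimp only
      rw [(hw i hi).2]
      exact hmap ⟨(hpath i hi).2.1, hZC (hpath i hi).2.2⟩
    · dsimp only
      rw [(hw k le_rfl).2]
      have hmem : leftProd h k • s.moving ∈ closure (U ∩ C) :=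
        closure_minimal (hC.open_subset_closure_inter hUo) isClosed_closure hcl
      exact closure_mono hUm.image_subset
        (((hf _ hkC).mono inter_subset_right).mem_closure_image hmem)
    · exact ⟨_, hnext, N₁, hN₁, (hUcl hcl).1, fun z hz => (hUcl (subset_closure hz)).1, haU, htr₁,
        hUm, (hw k le_rfl).2, rfl, rfl⟩
  · refine ⟨_, hs, univ, isOpen_univ, mem_univ _, subset_univ _, mem_univ _, ?_,
      fun _ _ => mem_univ _, rfl, rfl, rfl⟩
    intro z _ h _ _
    obtain ⟨w, hw⟩ : ∃ w : H, w • f z = f (h • z) := hom _ _ ⟨h, rfl⟩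
    exact ⟨w, mem_univ _, hw.symm⟩

end Transfer

/-! ### The invariant comeager set -/

theorem exists_invariant_comeager_sim_map {G H X Y : Type*}
    [Group G] [TopologicalSpace G] [IsTopologicalGroup G] [PolishSpace G]
    [Group H] [TopologicalSpace H] [IsTopologicalGroup H] [PolishSpace H]
    [TopologicalSpace X] [PolishSpace X] [MulAction G X] [ContinuousSMul G X]
    [TopologicalSpace Y] [PolishSpace Y] [MulAction H Y] [ContinuousSMul H Y]
    (f : X → Y) (hf : BaireMeasurable f) (hom : IsOrbitHom G H f)
    (α : Ordinal.{0}) (hα : α < Ordinal.omega 1) :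
    ∃ X₀ : Set X, X₀ ∈ residual X ∧ (∀ (g : G), ∀ x ∈ X₀, g • x ∈ X₀) ∧
      ∀ x ∈ X₀, ∀ y ∈ X₀, Sim G α x y → Sim H α (f x) (f y) := by
  obtain ⟨C, hC, hfC, hT⟩ := exists_comeager_tracks hf hom
  have hinv : ∀ (g : G), ∀ x ∈ {x : X | ∀ᶠ ε in residual G, ε • x ∈ C},
      g • x ∈ {x : X | ∀ᶠ ε in residual G, ε • x ∈ C} := by
    intro g x hx
    have hmul : Tendsto (fun k : G => k * g) (residual G) (residual G) :=
      tendsto_residual_of_isOpenMap (by fun_prop) (isOpenMap_mul_right g)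
    filter_upwards [hmul.eventually hx] with ε hε
    rwa [← mul_smul]
  refine ⟨{x | ∀ᶠ ε in residual G, ε • x ∈ C},
    eventually_residual_section (tendsto_action_residual.eventually hC), hinv, ?_⟩
  intro x hx y hy hsim
  obtain ⟨J, Z, hs, hZ, hZc, hJ, hJM⟩ := hsim.exists_countable hα hinv hx hy
  obtain ⟨ε, hε⟩ := (dense_of_mem_residual ((eventually_countable_ball hZc).2 hZ)).nonempty
  have hεC : {z : X | ε • z ∈ C} ∈ residual X :=
    tendsto_residual_of_isOpenMap (continuous_const_smul ε) (isOpenMap_smul ε) hC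
  -- The two values need different corrections: `c` is built into the map, so that the first point
  -- is exactly `f x`, and the second point is then moved to `f y` by `Sim.smul_right`.
  obtain ⟨c, hc⟩ : ∃ c : H, c • f (ε • x) = f x := hom _ _ ⟨ε⁻¹, by simp⟩
  obtain ⟨d, hd⟩ : ∃ d : H, d • f (ε • y) = f y := hom _ _ ⟨ε⁻¹, by simp⟩
  have key := hJM.sim_map (H := H) (f := fun z => c • f (ε • z)) (C := {z : X | ε • z ∈ C}) ?_
    (dense_of_mem_residual hεC) ?_ ?_ hs hε hJ
  · have := key.smul_right (d * c⁻¹)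
    rwa [hc, ← mul_smul, inv_mul_cancel_right, hd] at this
  · rintro _ x₂ ⟨g, rfl⟩
    obtain ⟨w, hw⟩ : ∃ w : H, w • f (ε • x₂) = f (ε • g • x₂) :=
      hom _ _ ⟨ε * g * ε⁻¹, by simp [mul_smul]⟩
    refine ⟨c * w * c⁻¹, ?_⟩
    simp [mul_smul, hw]
  · exact (hfC.comp (continuous_const_smul ε).continuousOn fun z hz => hz).const_smul c
  · intro W hW z hz
    -- Translating by `ε` and `c` conjugates the steps, and conjugation preserves neighborhoods of
    -- `1`.
    have hW' : {w : H | c * w * c⁻¹ ∈ W} ∈ 𝓝 (1 : H) := by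
      have hcont : ContinuousAt (fun w : H => c * w * c⁻¹) 1 :=
        Continuous.continuousAt (by fun_prop)
      exact hcont.preimage_mem_nhds (by simpa using hW)
    obtain ⟨N, hN, V, hV, ht⟩ := hT _ hW' _ hz
    refine ⟨{z | ε • z ∈ N}, (continuous_const_smul ε).continuousAt.preimage_mem_nhds hN,
      {v : G | ε * v * ε⁻¹ ∈ V}, ?_, ?_⟩
    · have hcont : ContinuousAt (fun w : G => ε * w * ε⁻¹) 1 :=
        Continuous.continuousAt (by fun_prop)
      exact hcont.preimage_mem_nhds (by simpa using hV)
    · intro z' hz' h hh hhz'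
      have he : (ε * h * ε⁻¹) • ε • z' = ε • h • z' := by simp [mul_smul]
      obtain ⟨w, hw, hwe⟩ := ht _ hz' _ hh (by rw [he]; exact hhz')
      refine ⟨c * w * c⁻¹, hw, ?_⟩
      rw [he] at hwe
      simp only [hwe, mul_smul, inv_smul_smul]

end ApprGame

theorem mainTheorem11 {G H X Y : Type*}
    [Group G] [TopologicalSpace G] [IsTopologicalGroup G] [PolishSpace G]
    [Group H] [TopologicalSpace H] [IsTopologicalGroup H] [PolishSpace H]
    [TopologicalSpace X] [PolishSpace X] [MulAction G X] [ContinuousSMul G X]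
    [TopologicalSpace Y] [PolishSpace Y] [MulAction H Y] [ContinuousSMul H Y]
    (f : X → Y) (hf : ApprGame.BaireMeasurable f) (hom : ApprGame.IsOrbitHom G H f)
    (α : Ordinal.{0}) (hα : α < Ordinal.omega 1) :
    ∃ X₀ : Set X, X₀ ∈ residual X ∧ (∀ (g : G), ∀ x ∈ X₀, g • x ∈ X₀) ∧
      ∀ x ∈ X₀, ∀ y ∈ X₀, ApprGame.Sim G α x y → ApprGame.Sim H α (f x) (f y) :=
  ApprGame.exists_invariant_comeager_sim_map f hf hom α hα
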